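/- Let $n\ge 2$ and $T\ge 1$ be integers. In the online threshold queries problem an algorithm receives at the start a finite set $S\subseteq[0,1]$; then, for $t=1,\dots,T$, it receives a query $q_t\in[0,1]$ and, before seeing the later queries, has to output a real number $a_t$ that approximates $c_t=|\{x\in S: x<q_t\}|$. The queries are non-adaptive: the sequence $(q_1,\dots,q_T)$ is fixed in advance and does not depend on the answers. The algorithm is randomized; it is $(\varepsilon,\delta)$-differentially private if for every query sequence, every two neighboring sets $S,S'$ and every measurable $F\subseteq\mathbb{R}^T$, $$\Pr[(a_1,\dots,a_T)\in F \text{ on input } S]\le e^{\varepsilon}\Pr[(a_1,\dots,a_T)\in F\text{ on input } S']+\delta .$$ Here "neighboring" may be read in either of the two usual ways: $S'$ arises from $S$ by adding or removing one point, or $S'$ arises from $S$ by replacing one point by another one. Then, for each of the two readings, there is no $(0.1,\frac1{n^2})$-differentially private algorithm such that for every set $S$ of $n$ reals from $[0,1]$ and every query sequence $q_1,\dots,q_T$, with probability at least $0.99$ all $T$ answers satisfy $$|a_t-c_t|\le \tfrac12\min\{n,\log_2 T\}\quad\text{and}\quad |a_t-c_t|<\tfrac n2 .$$ (The second condition only excludes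 error exactly $\frac n2$, which the constant answer $\frac n2$ never exceeds; it is implied by the first one when $\log_2 T<n$.) -/

import Mathlib

open MeasureTheory

/-- A randomized online algorithm for `T` threshold queries. Its random coins are a point `ω` of a
measurable space `Ω` (on which a probability measure is put later). At time `t` it outputs a real
number that may depend on the whole dataset, on the queries received up to and including time `t`,
and on the coins. The earlier answers and the internal state are functions of the same data. -/
structure OnlineThresholdAlgorithm (Ω : Type*) [MeasurableSpace Ω] (T : ℕ) where
  answer : Finset unitInterval → (t : Fin T) → (Set.Iic t → unitInterval) → Ω → ℝ
  measurable_answer : ∀ S t p, Measurable (answer S t p)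

/-- Two datasets are neighbors if one is obtained from the other by adding or removing one point. -/
def AddRemoveNeighbors (S S' : Finset unitInterval) : Prop :=
  ∃ x, (x ∉ S ∧ S' = insert x S) ∨ (x ∉ S' ∧ S = insert x S')

/-- Two datasets are neighbors if they have the same number of points and one is obtained from the
other by replacing one point by a different one. -/
def ReplaceNeighbors (S S' : Finset unitInterval) : Prop :=
  ∃ R x y, x ∉ R ∧ y ∉ R ∧ x ≠ y ∧ S = insert x R ∧ S' = insert y R

/-- The correct answer to the threshold query `x`: the number of data points smaller than `x`. -/
noncomputable def thresholdCount (S : Finset unitInterval) (x : unitInterval) : ℕ :=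
  (S.filter (fun y => y < x)).card

namespace OnlineThresholdAlgorithm

variable {Ω : Type*} [MeasurableSpace Ω] {T : ℕ}

/-- The sequence of all `T` answers, on dataset `S`, query sequence `q` and coins `ω`. -/
def releases (A : OnlineThresholdAlgorithm Ω T) (S : Finset unitInterval)
    (q : Fin T → unitInterval) (ω : Ω) : Fin T → ℝ :=
  fun t => A.answer S t ((Set.Iic t).domRestrict q) ω

/-- `(ε, δ)`-differential privacy of the sequence of all answers with respect to the dataset, for
every query sequence that is fixed in advance. -/
def IsDP (A : OnlineThresholdAlgorithm Ω T) (μ : Measure Ω)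
    (Nbr : Finset unitInterval → Finset unitInterval → Prop) (ε δ : ℝ) : Prop :=
  ∀ (q : Fin T → unitInterval) (S S' : Finset unitInterval), Nbr S S' →
    ∀ F : Set (Fin T → ℝ), MeasurableSet F →
      μ.real {ω | A.releases S q ω ∈ F} ≤ Real.exp ε * μ.real {ω | A.releases S' q ω ∈ F} + δ

/-- The absolute error of the answer to the `t`-th query. -/
noncomputable def error (A : OnlineThresholdAlgorithm Ω T) (S : Finset unitInterval)
    (q : Fin T → unitInterval) (ω : Ω) (t : Fin T) : ℝ :=
  |A.releases S q ω t - (thresholdCount S (q t) : ℝ)|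

end OnlineThresholdAlgorithm

/-! Comparing answers with `θ` turns an accurate algorithm into an alarm that stays silent while the
count is 0 and has been raised once it is `k = min n (Nat.log 2 T + 1)`. Let the queries increase,
so that a point arrives at the first query beyond it. All points start after the last query, where
an alarm is unlikely; `k` of them are then moved, one by one, to the start of a window that is
halved each time, keeping the half where a first alarm is less likely. Halving outweighs the privacy
factor `r < 2`, so `k` points arrive while an alarm is still unlikely
(`exists_arrivals_first_alarm_le`).

That argument needs an alarm that cannot foresee arrivals, yet the algorithm knows the whole dataset
from the start. So positions are taken generic along an ultrafilter: limiting probabilities depend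
only on relative order (`map_comp_genericIncreasing_congr`), and the queries up to time `t` do not
reveal where later points fall among later queries (`alarmProb_congr`).

Replacing a point is a removal and an addition, which costs constants. They are too weak only for `n
= k = 2`, where a packing of three datasets around the empty one is used. -/

open Filter Topology

/-! ### Halving argument for first alarms -/

/-- A lower bound for monitoring a growing count. `F c t` is the probability that the first alarm is
raised at time `t` when the `s`-th point arrives at time `c s`, and `c s = T` means that it never
arrives. -/
theorem exists_arrivals_first_alarm_le {n T k : ℕ} (F : (Fin n → Fin (T + 1)) → ℕ → ℝ)
    {r δ η : ℝ} (hr : 1 ≤ r) (hr2 : r < 2) (hF : ∀ c t, 0 ≤ F c t)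
    (hk : 1 ≤ k) (hkn : k ≤ n) (hkT : 2 ^ (k - 1) ≤ T)
    (hpriv : ∀ c j x, Monotone c → Monotone (Function.update c j x) → c j ≠ x → ∀ I : Finset ℕ,
      ∑ t ∈ I, F (Function.update c j x) t ≤ r * ∑ t ∈ I, F c t + δ)
    (honline : ∀ (c c' : Fin n → Fin (T + 1)) (t : ℕ), Monotone c → Monotone c' →
      (∀ s, c s = c' s ∨ (t < (c s : ℕ) ∧ t < (c' s : ℕ))) → F c t = F c' t)
    (h0 : ∑ t ∈ Finset.range T, F (fun _ => Fin.last T) t ≤ η) :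
    ∃ (c : Fin n → Fin (T + 1)) (l : ℕ), Monotone c ∧ l < T ∧ (∀ s : Fin n, s.1 < k → (c s : ℕ) ≤ l) ∧
      (∀ s : Fin n, k ≤ s.1 → c s = Fin.last T) ∧
      ∑ t ∈ Finset.range (l + 1), F c t ≤ (r * η + k * δ) / (2 - r) := by
  -- `C` solves `C * r = 2 * C - 1`, which makes the potential in `key` grow by at most `C * δ` per
  -- move.
  set C : ℝ := 1 / (2 - r) with hC
  have hC1 : 1 ≤ C := by rw [hC, le_div_iff₀ (by linarith)]; linarith
  have hCr : C * r = 2 * C - 1 := by rw [hC]; field_simp [(by linarith : 2 - r ≠ 0)]; ring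
  -- moving the next point from the end to time `l` keeps the arrival times monotone
  have hmono : ∀ (c : Fin n → Fin (T + 1)) (j : ℕ) (hj : j < n) (x : Fin (T + 1)), Monotone c →
      (∀ s : Fin n, s.1 < j → c s ≤ x) → (∀ s : Fin n, j ≤ s.1 → c s = Fin.last T) →
      Monotone (Function.update c ⟨j, hj⟩ x) := by
    intro c j hj x hc h1 h2 s s' hss
    by_cases e : s = ⟨j, hj⟩ <;> by_cases e' : s' = ⟨j, hj⟩
    · simp [e, e']
    · subst e
      rw [Function.update_self, Function.update_of_ne e', h2 s' hss]
      exact Fin.le_last _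
    · subst e'
      rw [Function.update_self, Function.update_of_ne e]
      refine h1 s (lt_of_le_of_ne hss fun h => e (Fin.ext h))
    · rw [Function.update_of_ne e, Function.update_of_ne e']
      exact hc hss
  -- Potential: alarm mass before the window plus `C` times the mass inside it. The window starts at
  -- `l` and has length `2 ^ (k - (j + 1))` after `j + 1` points have been moved.
  have key : ∀ j, j + 1 ≤ k → ∃ (c : Fin n → Fin (T + 1)) (l : ℕ), Monotone c ∧
      l + 2 ^ (k - (j + 1)) ≤ T ∧ (∀ s : Fin n, s.1 < j + 1 → (c s : ℕ) ≤ l) ∧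
      (∀ s : Fin n, j + 1 ≤ s.1 → c s = Fin.last T) ∧
      ∑ t ∈ Finset.range l, F c t + C * ∑ t ∈ Finset.Ico l (l + 2 ^ (k - (j + 1))), F c t
        ≤ C * (r * η + (j + 1 : ℕ) * δ) := by
    intro j
    induction j with
    | zero =>
      intro _
      have hT : 0 < T := lt_of_lt_of_le (by positivity) hkT
      have hm := hmono (fun _ => Fin.last T) 0 (by omega) 0 (fun _ _ _ => le_rfl)
        (fun s hs => absurd hs (by omega)) (fun _ _ => rfl)
      refine ⟨_, 0, hm, by simpa using hkT, ?_, ?_, ?_⟩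
      · intro s hs
        have : s = ⟨0, by omega⟩ := Fin.ext (by simpa using hs)
        simp [this]
      · intro s hs
        rw [Function.update_of_ne]
        rintro rfl
        simp at hs
      · have h1 := hpriv (fun _ => Fin.last T) ⟨0, by omega⟩ 0 (fun _ _ _ => le_rfl) hm
          (by rw [Ne, Fin.ext_iff]; simp; omega) (Finset.Ico 0 (0 + 2 ^ (k - (0 + 1))))
        have h2 : ∑ t ∈ Finset.Ico 0 (0 + 2 ^ (k - (0 + 1))), F (fun _ => Fin.last T) t ≤ η := by
          refine le_trans (Finset.sum_le_sum_of_subset_of_nonneg ?_ fun _ _ _ => hF _ _) h0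
          intro t ht
          simp at ht ⊢
          omega
        simp only [Finset.range_zero, Finset.sum_empty, zero_add, Nat.cast_one, one_mul] at h1 h2 ⊢
        refine mul_le_mul_of_nonneg_left (h1.trans ?_) (by linarith)
        gcongr
    | succ j ih =>
      intro hj
      obtain ⟨c, l, hc, hl, hc1, hc2, hpot⟩ := ih (by omega)
      have hpow : 2 ^ (k - (j + 1)) = 2 ^ (k - (j + 1 + 1)) + 2 ^ (k - (j + 1 + 1)) := by
        rw [show k - (j + 1) = k - (j + 1 + 1) + 1 by omega, pow_succ]; ring
      set w := 2 ^ (k - (j + 1 + 1)) with hw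
      have hwpos : 0 < w := by positivity
      rw [hpow] at hl hpot
      have hmove : ∀ l', l ≤ l' → l' < T → ∃ c' : Fin n → Fin (T + 1), Monotone c' ∧
          (∀ s : Fin n, s.1 < j + 1 + 1 → (c' s : ℕ) ≤ l') ∧
          (∀ s : Fin n, j + 1 + 1 ≤ s.1 → c' s = Fin.last T) ∧
          ∑ t ∈ Finset.range l', F c' t = ∑ t ∈ Finset.range l', F c t ∧
          ∑ t ∈ Finset.Ico l' (l' + w), F c' t ≤ r * ∑ t ∈ Finset.Ico l' (l' + w), F c t + δ := by
        intro l' hl' hl'T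
        have hm := hmono c (j + 1) (by omega) ⟨l', by omega⟩ hc
          (fun s hs => Fin.mk_le_mk.2 ((hc1 s hs).trans hl')) hc2
        refine ⟨_, hm, ?_, ?_, ?_, ?_⟩
        · intro s hs
          by_cases e : s = ⟨j + 1, by omega⟩
          · simp [e]
          · rw [Function.update_of_ne e]
            have : s.1 ≠ j + 1 := fun h => e (Fin.ext h)
            exact (hc1 s (by omega)).trans hl'
        · intro s hs
          rw [Function.update_of_ne]
          · exact hc2 s (by omega)
          · rintro rfl
            simp at hs
        · refine Finset.sum_congr rfl fun t ht => honline _ _ _ hm hc fun s => ?_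
          simp only [Finset.mem_range] at ht
          by_cases e : s = ⟨j + 1, by omega⟩
          · right
            subst e
            rw [Function.update_self, hc2 _ le_rfl]
            simp
            omega
          · left
            rw [Function.update_of_ne e]
        · refine hpriv _ _ _ hc hm ?_ _
          rw [hc2 _ le_rfl, Ne, Fin.ext_iff]
          simp
          omega
      have hsplit := Finset.sum_Ico_consecutive (F c) (show l ≤ l + w by omega)
        (show l + w ≤ l + (w + w) by omega)
      have hrange := Finset.sum_range_add_sum_Ico (F c) (show l ≤ l + w by omega)
      -- The lighter half becomes the new window, and the next point arrives at its start. If it is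
      -- the second half, the mass of the first joins the part before the window, where it counts
      -- with weight 1 and is unaffected by the move.
      rcases le_total (∑ t ∈ Finset.Ico l (l + w), F c t)
        (∑ t ∈ Finset.Ico (l + w) (l + (w + w)), F c t) with h | h
      · obtain ⟨c', hm, h1, h2, h3, h4⟩ := hmove l le_rfl (by omega)
        refine ⟨c', l, hm, by omega, h1, h2, ?_⟩
        rw [h3]
        have h5 := mul_le_mul_of_nonneg_left h4 (by linarith : 0 ≤ C)
        have h6 : 0 ≤ ∑ t ∈ Finset.Ico l (l + w), F c t := Finset.sum_nonneg fun _ _ => hF _ _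
        rw [← hsplit] at hpot
        generalize ∑ t ∈ Finset.Ico (l + w) (l + (w + w)), F c t = y at *
        generalize ∑ t ∈ Finset.Ico l (l + w), F c t = x at *
        push_cast at hpot ⊢
        have h7 : C * (r * x) = 2 * (C * x) - x := by linear_combination x * hCr
        have h8 := mul_nonneg (by linarith : 0 ≤ C) (sub_nonneg.2 h)
        linarith
      · obtain ⟨c', hm, h1, h2, h3, h4⟩ := hmove (l + w) (by omega) (by omega)
        refine ⟨c', l + w, hm, by omega, h1, h2, ?_⟩
        rw [h3, ← hrange]
        rw [show l + (w + w) = l + w + w by ring] at *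
        have h5 := mul_le_mul_of_nonneg_left h4 (by linarith : 0 ≤ C)
        rw [← hsplit] at hpot
        generalize ∑ t ∈ Finset.Ico (l + w) (l + w + w), F c t = y at *
        generalize ∑ t ∈ Finset.Ico l (l + w), F c t = x at *
        push_cast at hpot ⊢
        have h7 : C * (r * y) = 2 * (C * y) - y := by linear_combination y * hCr
        have h8 := mul_nonneg (sub_nonneg.2 hC1) (sub_nonneg.2 h)
        linarith
  -- After `k` moves the window is the single time `l`.
  obtain ⟨c, l, hc, hl, hc1, hc2, hpot⟩ := key (k - 1) (by omega)
  rw [Nat.sub_add_cancel hk] at hl hc1 hc2 hpot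
  simp only [Nat.sub_self, pow_zero, Nat.Ico_succ_singleton, Finset.sum_singleton] at hl hpot
  refine ⟨c, l, hc, by omega, hc1, hc2, ?_⟩
  rw [Finset.sum_range_succ, div_eq_inv_mul, ← one_div]
  have := mul_le_mul_of_nonneg_right hC1 (hF c l)
  linarith

/-! ### Generic increasing tuples -/

/-- The iterated product of the hyperfilter on `ℕ`: its generic member is a tuple each of whose
entries is infinitely large compared with the previous ones. -/
noncomputable def genericTuple : (m : ℕ) → Ultrafilter (Fin m → ℕ)
  | 0 => pure Fin.elim0
  | m + 1 => (hyperfilter ℕ).bind fun i =>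
      (genericTuple m).map fun v => (Fin.cons i v : Fin (m + 1) → ℕ)

theorem eventually_genericTuple_succ {m : ℕ} {p : (Fin (m + 1) → ℕ) → Prop} :
    (∀ᶠ v : Fin (m + 1) → ℕ in (genericTuple (m + 1) : Filter _), p v) ↔
      ∀ᶠ i in (hyperfilter ℕ : Filter ℕ),
        ∀ᶠ v : Fin m → ℕ in (genericTuple m : Filter _), p (Fin.cons i v) :=
  Iff.rfl

/-- The lower bound `b` is there for the induction: the tail has to exceed the head. -/
theorem eventually_strictMono_genericTuple (m : ℕ) :
    ∀ b, ∀ᶠ v : Fin m → ℕ in (genericTuple m : Filter _), StrictMono v ∧ ∀ a, b ≤ v a := by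
  induction m with
  | zero => exact fun b => Eventually.of_forall fun v => ⟨fun a => a.elim0, fun a => a.elim0⟩
  | succ m ih =>
    intro b
    rw [eventually_genericTuple_succ]
    have hb : ∀ᶠ i in (hyperfilter ℕ : Filter ℕ), b ≤ i :=
      Nat.hyperfilter_le_atTop (eventually_ge_atTop b)
    filter_upwards [hb] with i hi
    filter_upwards [ih (i + 1)] with v hv
    refine ⟨Fin.strictMono_iff_lt_succ.2 ?_, ?_⟩
    · intro a
      cases m with
      | zero => exact a.elim0
      | succ m =>
        refine Fin.cases ?_ (fun a => ?_) a
        · exact hv.2 0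
        · exact hv.1 (Fin.castSucc_lt_succ (i := a))
    · refine Fin.cases hi fun a => ?_
      have := hv.2 a
      simp only [Fin.cons_succ]
      omega

/-- A subtuple of a generic tuple is generic: quantifying over a coordinate that `φ` skips has no
effect. -/
theorem eventually_comp_genericTuple (M : ℕ) :
    ∀ {m : ℕ} {φ : Fin m → Fin M}, StrictMono φ → ∀ p : (Fin m → ℕ) → Prop,
      (∀ᶠ v in genericTuple M, p (v ∘ φ)) ↔ ∀ᶠ w in genericTuple m, p w := by
  induction M with
  | zero =>
    intro m φ _ p
    cases m with
    | zero =>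
      rw [show (fun v => p (v ∘ φ)) = p from funext fun v => by rw [Subsingleton.elim (v ∘ φ) v]]
    | succ m => exact (φ 0).elim0
  | succ M ih =>
    intro m φ hφ p
    rw [eventually_genericTuple_succ]
    by_cases h0 : ∃ a, φ a = 0
    · cases m with
      | zero => exact h0.choose.elim0
      | succ m =>
        obtain ⟨a, ha⟩ := h0
        have hφ0 : φ 0 = 0 := le_antisymm (ha ▸ hφ.monotone (Fin.zero_le a)) (Fin.zero_le _)
        have hne : ∀ a : Fin m, φ a.succ ≠ 0 := fun a =>
          hφ0 ▸ (hφ (Fin.succ_pos a)).ne'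
        rw [eventually_genericTuple_succ]
        refine eventually_congr (Eventually.of_forall fun i => ?_)
        rw [← ih (φ := fun a => (φ a.succ).pred (hne a))
          (fun a b hab => by simpa using hφ (Fin.succ_lt_succ_iff.2 hab))]
        refine eventually_congr (Eventually.of_forall fun v => ?_)
        have : (Fin.cons i v : Fin (M + 1) → ℕ) ∘ φ =
            Fin.cons i (v ∘ fun a => (φ a.succ).pred (hne a)) := by
          funext a
          refine Fin.cases ?_ (fun a => ?_) a
          · simp [hφ0]
          · conv_lhs => rw [Function.comp_apply, ← Fin.succ_pred _ (hne a), Fin.cons_succ]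
            rfl
        rw [this]
    · push Not at h0
      have hstep : ∀ i, (∀ᶠ v in genericTuple M, p ((Fin.cons i v : Fin (M + 1) → ℕ) ∘ φ)) ↔
          ∀ᶠ w in genericTuple m, p w := by
        intro i
        rw [← ih (φ := fun a => (φ a).pred (h0 a)) (fun a b hab => by simpa using hφ hab)]
        refine eventually_congr (Eventually.of_forall fun v => ?_)
        have : (Fin.cons i v : Fin (M + 1) → ℕ) ∘ φ = v ∘ fun a => (φ a).pred (h0 a) := by
          funext a
          conv_lhs => rw [Function.comp_apply, ← Fin.succ_pred _ (h0 a), Fin.cons_succ]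
          rfl
        rw [this]
      simp only [hstep, eventually_const]

/-- The ultrafilter of generic increasing functions on a finite linear order. -/
noncomputable def genericIncreasing (σ : Type*) [Fintype σ] [LinearOrder σ] :
    Ultrafilter (σ → ℕ) :=
  (genericTuple (Fintype.card σ)).map fun v => v ∘ (Fintype.orderIsoFinOfCardEq σ rfl).symm

theorem eventually_strictMono_genericIncreasing (σ : Type*) [Fintype σ] [LinearOrder σ] :
    ∀ᶠ v : σ → ℕ in (genericIncreasing σ : Filter _), StrictMono v := by
  change ∀ᶠ v : Fin (Fintype.card σ) → ℕ in (genericTuple (Fintype.card σ) : Filter _),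
    StrictMono (v ∘ (Fintype.orderIsoFinOfCardEq σ rfl).symm)
  filter_upwards [eventually_strictMono_genericTuple (Fintype.card σ) 0] with v hv
  exact hv.1.comp (OrderIso.strictMono _)

/-- The behaviour of a generic increasing function on some places depends only on their order. -/
theorem map_comp_genericIncreasing_congr {σ τ : Type*} [Fintype σ] [LinearOrder σ] [Fintype τ]
    {ψ ψ' : τ → σ} (hψ : Function.Injective ψ) (h : ∀ a b, ψ a < ψ b ↔ ψ' a < ψ' b) :
    (genericIncreasing σ).map (fun v => v ∘ ψ) = (genericIncreasing σ).map (fun v => v ∘ ψ') := by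
  -- For the order pulled back along `ψ`, both maps are strictly increasing, so both pushforwards
  -- are the generic one on `τ`.
  let _ : LinearOrder τ := LinearOrder.lift' ψ hψ
  have hmono : StrictMono ψ := fun _ _ hab => hab
  have hmono' : StrictMono ψ' := fun a b hab => (h a b).1 hab
  have key : ∀ χ : τ → σ, StrictMono χ → (genericIncreasing σ).map (fun v => v ∘ χ) =
      (genericTuple (Fintype.card τ)).map
        fun v => v ∘ (Fintype.orderIsoFinOfCardEq τ rfl).symm := by
    intro χ hχ
    ext s
    have := eventually_comp_genericTuple (Fintype.card σ)
      (φ := fun a => (Fintype.orderIsoFinOfCardEq σ rfl).symm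
        (χ (Fintype.orderIsoFinOfCardEq τ rfl a)))
      ((OrderIso.strictMono _).comp (hχ.comp (OrderIso.strictMono _)))
      (fun w => w ∘ (Fintype.orderIsoFinOfCardEq τ rfl).symm ∈ s)
    refine Iff.trans ?_ this
    change (∀ᶠ v in (genericTuple (Fintype.card σ) : Filter _),
      (v ∘ (Fintype.orderIsoFinOfCardEq σ rfl).symm) ∘ χ ∈ s) ↔ _
    refine eventually_congr (Eventually.of_forall fun v => ?_)
    have : (v ∘ (Fintype.orderIsoFinOfCardEq σ rfl).symm) ∘ χ =
        (v ∘ fun a => (Fintype.orderIsoFinOfCardEq σ rfl).symm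
        (χ (Fintype.orderIsoFinOfCardEq τ rfl a))) ∘ (Fintype.orderIsoFinOfCardEq τ rfl).symm := by
      funext a
      simp
    exact this ▸ Iff.rfl
  rw [key ψ hmono, key ψ' hmono']

/-! ### Ultralimits, sample points and first-alarm events -/

theorem Ultrafilter.tendsto_limUnder_of_mem_Icc {α : Type*} (V : Ultrafilter α) {f : α → ℝ} {a b : ℝ}
    (hf : ∀ v, f v ∈ Set.Icc a b) : Tendsto f V (𝓝 (limUnder V f)) := by
  refine tendsto_nhds_limUnder ?_
  obtain ⟨x, -, hx⟩ := (isCompact_Icc (a := a) (b := b)).ultrafilter_le_nhds (V.map f)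
    (le_principal_iff.2 (Eventually.of_forall hf : ∀ᶠ v in V, f v ∈ Set.Icc a b))
  exact ⟨x, hx⟩

/-- An increasing sequence of points of the unit interval. -/
noncomputable def increasingPoint (i : ℕ) : unitInterval :=
  ⟨i / (i + 1), by positivity, by rw [div_le_one (by positivity)]; linarith⟩

theorem strictMono_increasingPoint : StrictMono increasingPoint := by
  intro i j h
  have h' : (i : ℝ) < j := by exact_mod_cast h
  change (i / (i + 1) : ℝ) < j / (j + 1)
  rw [div_lt_div_iff₀ (by positivity) (by positivity)]
  nlinarith

/-- The vectors of answers that exceed `θ` at time `t` for the first time. -/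
def firstAlarmAt {T : ℕ} (θ : ℝ) (t : ℕ) : Set (Fin T → ℝ) :=
  {y | (∃ h : t < T, θ < y ⟨t, h⟩) ∧ ∀ u : Fin T, u.1 < t → y u ≤ θ}

theorem measurableSet_firstAlarmAt {T : ℕ} (θ : ℝ) (t : ℕ) :
    MeasurableSet (firstAlarmAt (T := T) θ t) := by
  have h1 : MeasurableSet {y : Fin T → ℝ | ∃ h : t < T, θ < y ⟨t, h⟩} := by
    by_cases h : t < T
    · simp only [h, exists_true_left]
      exact measurableSet_lt measurable_const (measurable_pi_apply _)
    · simp [h]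
  have h2 : MeasurableSet {y : Fin T → ℝ | ∀ u : Fin T, u.1 < t → y u ≤ θ} := by
    simp only [Set.ofPred_forall]
    exact MeasurableSet.iInter fun u => MeasurableSet.iInter fun _ =>
      measurableSet_le (measurable_pi_apply _) measurable_const
  exact h1.inter h2

theorem disjoint_firstAlarmAt {T : ℕ} (θ : ℝ) {t u : ℕ} (h : t ≠ u) :
    Disjoint (firstAlarmAt (T := T) θ t) (firstAlarmAt θ u) := by
  wlog hlt : t < u generalizing t u
  · exact (this h.symm (by omega)).symm
  rw [Set.disjoint_left]
  rintro y ⟨⟨h1, h2⟩, -⟩ ⟨-, h3⟩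
  exact absurd (h3 ⟨t, h1⟩ hlt) (not_le.2 h2)

theorem exists_mem_firstAlarmAt {T : ℕ} {θ : ℝ} {y : Fin T → ℝ} (u : Fin T) (h : θ < y u) :
    ∃ t ≤ u.1, y ∈ firstAlarmAt θ t := by
  classical
  have hex : ∃ t, ∃ h : t < T, θ < y ⟨t, h⟩ := ⟨u.1, u.2, h⟩
  refine ⟨Nat.find hex, Nat.find_min' hex ⟨u.2, h⟩, Nat.find_spec hex, fun v hv => ?_⟩
  have := Nat.find_min hex hv
  push Not at this
  exact this v.2

namespace OnlineThresholdAlgorithm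

variable {Ω : Type*} [MeasurableSpace Ω] {T : ℕ}

theorem measurable_releases (A : OnlineThresholdAlgorithm Ω T) (S : Finset unitInterval)
    (q : Fin T → unitInterval) : Measurable (A.releases S q) :=
  measurable_pi_iff.2 fun t => A.measurable_answer S t _

theorem releases_congr (A : OnlineThresholdAlgorithm Ω T) (S : Finset unitInterval)
    {q q' : Fin T → unitInterval} {t : Fin T} (h : ∀ u ≤ t, q u = q' u) (ω : Ω) :
    A.releases S q ω t = A.releases S q' ω t := by
  have : (Set.Iic t).domRestrict q = (Set.Iic t).domRestrict q' := funext fun u => h u u.2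
  rw [releases, releases, this]

/-- The probability that the released answers lie in `F`. -/
noncomputable def releaseProb (A : OnlineThresholdAlgorithm Ω T) (μ : Measure Ω)
    (S : Finset unitInterval) (q : Fin T → unitInterval) (F : Set (Fin T → ℝ)) : ℝ :=
  μ.real {ω | A.releases S q ω ∈ F}

theorem releaseProb_mem_Icc (A : OnlineThresholdAlgorithm Ω T) (μ : Measure Ω)
    [IsProbabilityMeasure μ] (S : Finset unitInterval) (q : Fin T → unitInterval)
    (F : Set (Fin T → ℝ)) : A.releaseProb μ S q F ∈ Set.Icc (0 : ℝ) 1 :=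
  ⟨measureReal_nonneg, measureReal_le_one⟩

theorem releaseProb_biUnion (A : OnlineThresholdAlgorithm Ω T) (μ : Measure Ω)
    [IsProbabilityMeasure μ] (S : Finset unitInterval) (q : Fin T → unitInterval) (θ : ℝ)
    (I : Finset ℕ) :
    A.releaseProb μ S q (⋃ t ∈ I, firstAlarmAt θ t) =
      ∑ t ∈ I, A.releaseProb μ S q (firstAlarmAt θ t) := by
  have : {ω | A.releases S q ω ∈ ⋃ t ∈ I, firstAlarmAt θ t} =
      ⋃ t ∈ I, {ω | A.releases S q ω ∈ firstAlarmAt θ t} := by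
    ext ω; simp
  rw [releaseProb, this, measureReal_biUnion_finset]
  · rfl
  · intro t _ u _ h
    exact (disjoint_firstAlarmAt θ h).preimage (A.releases S q)
  · exact fun t _ => A.measurable_releases S q (measurableSet_firstAlarmAt θ t)

/-- A first alarm at `t` is decided by the answers up to `t`, and these see only the queries up to
`t`. -/
theorem releaseProb_firstAlarmAt_congr (A : OnlineThresholdAlgorithm Ω T) (μ : Measure Ω)
    (S : Finset unitInterval) {q q' : Fin T → unitInterval} (θ : ℝ) {t : ℕ}
    (h : ∀ u : Fin T, u.1 ≤ t → q u = q' u) :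
    A.releaseProb μ S q (firstAlarmAt θ t) = A.releaseProb μ S q' (firstAlarmAt θ t) := by
  have h1 : ∀ u : Fin T, u.1 ≤ t → ∀ ω, A.releases S q ω u = A.releases S q' ω u :=
    fun u hu ω => A.releases_congr S (fun w hw => h w (le_trans hw hu)) ω
  unfold releaseProb
  congr 1
  ext ω
  refine and_congr (exists_congr fun ht => ?_) (forall_congr' fun u => imp_congr_right fun hu => ?_)
  · rw [h1 _ le_rfl]
  · rw [h1 _ hu.le]

end OnlineThresholdAlgorithm

/-! ### Placing data points and queries -/

/-- The order in which data points and queries are placed on the line: the position `(t, s)` with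
`s < n` is meant for the `s`-th data point if it precedes the `t`-th query, which has the position
`(t, n)`. -/
abbrev Place (n T : ℕ) := Fin (T + 1) ×ₗ Fin (n + 1)

/-- The second coordinate keeps points with equal arrival time distinct and puts them before the
query of that time. -/
def pointPlace {n T : ℕ} (c : Fin n → Fin (T + 1)) (s : Fin n) : Place n T :=
  toLex (c s, s.castSucc)

def queryPlace (n : ℕ) {T : ℕ} (t : Fin T) : Place n T :=
  toLex (t.castSucc, Fin.last n)

theorem pointPlace_strictMono {n T : ℕ} {c : Fin n → Fin (T + 1)} (hc : Monotone c) :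
    StrictMono (pointPlace c) := by
  intro s s' h
  rw [pointPlace, pointPlace, Prod.Lex.toLex_lt_toLex]
  rcases (hc h.le).lt_or_eq with h1 | h1
  · exact Or.inl h1
  · exact Or.inr ⟨h1, h⟩

theorem pointPlace_lt_queryPlace {n T : ℕ} {c : Fin n → Fin (T + 1)} {s : Fin n} {t : Fin T} :
    pointPlace c s < queryPlace n t ↔ (c s : ℕ) ≤ t := by
  rw [pointPlace, queryPlace, Prod.Lex.toLex_lt_toLex]
  simp only [Fin.castSucc_lt_last, and_true]
  rw [← le_iff_lt_or_eq]
  rfl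

theorem queryPlace_lt_pointPlace {n T : ℕ} {c : Fin n → Fin (T + 1)} {s : Fin n} {t : Fin T} :
    queryPlace n t < pointPlace c s ↔ (t : ℕ) < c s := by
  rw [pointPlace, queryPlace, Prod.Lex.toLex_lt_toLex]
  simp only [Fin.lt_def, Fin.val_last, Fin.val_castSucc]
  have := s.2
  omega

theorem queryPlace_strictMono (n T : ℕ) : StrictMono (queryPlace n (T := T)) := by
  intro t u h
  rw [queryPlace, queryPlace, Prod.Lex.toLex_lt_toLex]
  exact Or.inl h

/-- The dataset obtained by placing the points as `c` says. -/
noncomputable def placedData {n T : ℕ} (c : Fin n → Fin (T + 1)) (v : Place n T → ℕ) :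
    Finset unitInterval :=
  Finset.univ.image fun s => increasingPoint (v (pointPlace c s))

noncomputable def placedQuery {n T : ℕ} (v : Place n T → ℕ) (t : Fin T) : unitInterval :=
  increasingPoint (v (queryPlace n t))

theorem placedData_card {n T : ℕ} {c : Fin n → Fin (T + 1)} (hc : Monotone c)
    {v : Place n T → ℕ} (hv : StrictMono v) : (placedData c v).card = n := by
  rw [placedData, Finset.card_image_of_injective, Finset.card_univ, Fintype.card_fin]
  exact (strictMono_increasingPoint.comp (hv.comp (pointPlace_strictMono hc))).injective

theorem thresholdCount_placedData {n T : ℕ} {c : Fin n → Fin (T + 1)} (hc : Monotone c)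
    {v : Place n T → ℕ} (hv : StrictMono v) (t : Fin T) :
    thresholdCount (placedData c v) (placedQuery v t) =
      (Finset.univ.filter fun s => (c s : ℕ) ≤ t).card := by
  have hinj := (strictMono_increasingPoint.comp (hv.comp (pointPlace_strictMono hc))).injective
  rw [thresholdCount, placedData, Finset.filter_image]
  refine (Finset.card_image_of_injective _ hinj).trans
    (congrArg Finset.card (Finset.filter_congr fun s _ => ?_))
  rw [← pointPlace_lt_queryPlace, ← hv.lt_iff_lt, ← strictMono_increasingPoint.lt_iff_lt]
  rfl

theorem replaceNeighbors_placedData {n T : ℕ} {c : Fin n → Fin (T + 1)} {j : Fin n}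
    {x : Fin (T + 1)} (hc : Monotone c) (hc' : Monotone (Function.update c j x)) (hx : c j ≠ x)
    {v : Place n T → ℕ} (hv : StrictMono v) :
    ReplaceNeighbors (placedData (Function.update c j x) v) (placedData c v) := by
  have hz := strictMono_increasingPoint.comp hv
  have hR : ∀ s ∈ Finset.univ.erase j, pointPlace (Function.update c j x) s = pointPlace c s := by
    intro s hs
    simp [pointPlace, Finset.ne_of_mem_erase hs]
  have himg : ∀ d : Fin n → Fin (T + 1), placedData d v =
      insert (increasingPoint (v (pointPlace d j)))
        ((Finset.univ.erase j).image fun s => increasingPoint (v (pointPlace d s))) := by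
    intro d
    rw [placedData, ← Finset.insert_erase (Finset.mem_univ j), Finset.image_insert,
      Finset.insert_erase (Finset.mem_univ j)]
  have hnot : ∀ d : Fin n → Fin (T + 1), Monotone d → increasingPoint (v (pointPlace d j)) ∉
        (Finset.univ.erase j).image fun s => increasingPoint (v (pointPlace d s)) := by
    intro d hd hmem
    obtain ⟨s, hs, h⟩ := Finset.mem_image.1 hmem
    exact Finset.ne_of_mem_erase hs ((hz.comp (pointPlace_strictMono hd)).injective h)
  have hcongr : ((Finset.univ.erase j).image fun s =>
        increasingPoint (v (pointPlace (Function.update c j x) s))) =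
      (Finset.univ.erase j).image fun s => increasingPoint (v (pointPlace c s)) :=
    Finset.image_congr fun s hs => by rw [hR s hs]
  refine ⟨_, _, _, hcongr ▸ hnot _ hc', hnot _ hc, ?_, hcongr ▸ himg _, himg _⟩
  intro h
  have := hz.injective h
  simp [pointPlace] at this
  exact hx this.symm

/-! ### Limiting alarm probabilities and the replacement bound -/

namespace OnlineThresholdAlgorithm

variable {Ω : Type*} [MeasurableSpace Ω] {T : ℕ}

/-- The limiting probability that the first answer above `θ` is given at time `t` when data points and
queries are generic subject to the order prescribed by `c`. -/
noncomputable def alarmProb (A : OnlineThresholdAlgorithm Ω T) (μ : Measure Ω) (θ : ℝ) {n : ℕ}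
    (c : Fin n → Fin (T + 1)) (t : ℕ) : ℝ :=
  limUnder (genericIncreasing (Place n T) : Filter (Place n T → ℕ))
    fun v => A.releaseProb μ (placedData c v) (placedQuery v) (firstAlarmAt θ t)

theorem tendsto_alarmProb (A : OnlineThresholdAlgorithm Ω T) (μ : Measure Ω)
    [IsProbabilityMeasure μ] (θ : ℝ) {n : ℕ} (c : Fin n → Fin (T + 1)) (I : Finset ℕ) :
    Tendsto (fun v => A.releaseProb μ (placedData c v) (placedQuery v)
        (⋃ t ∈ I, firstAlarmAt θ t))
      (genericIncreasing (Place n T) : Filter (Place n T → ℕ))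
      (𝓝 (∑ t ∈ I, A.alarmProb μ θ c t)) := by
  simp only [releaseProb_biUnion]
  exact tendsto_finsetSum _ fun t _ => (genericIncreasing (Place n T)).tendsto_limUnder_of_mem_Icc
    fun v => A.releaseProb_mem_Icc μ _ _ _

theorem alarmProb_nonneg (A : OnlineThresholdAlgorithm Ω T) (μ : Measure Ω)
    [IsProbabilityMeasure μ] (θ : ℝ) {n : ℕ} (c : Fin n → Fin (T + 1)) (t : ℕ) :
    0 ≤ A.alarmProb μ θ c t := by
  have := ge_of_tendsto' (A.tendsto_alarmProb μ θ c {t})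
    fun v => (A.releaseProb_mem_Icc μ _ _ _).1
  simpa using this

/-- The first alarm at time `t` does not depend on where the points beyond the first `t` queries are
placed among the later queries. -/
theorem alarmProb_congr (A : OnlineThresholdAlgorithm Ω T) (μ : Measure Ω) (θ : ℝ) {n : ℕ}
    {c c' : Fin n → Fin (T + 1)} {t : ℕ} (hc : Monotone c) (hc' : Monotone c')
    (h : ∀ s, c s = c' s ∨ (t < (c s : ℕ) ∧ t < (c' s : ℕ))) :
    A.alarmProb μ θ c t = A.alarmProb μ θ c' t := by
  let σ := Fin n ⊕ {u : Fin T // u.1 ≤ t}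
  let ψ : (Fin n → Fin (T + 1)) → σ → Place n T :=
    fun c => Sum.elim (pointPlace c) fun u => queryPlace n u.1
  -- `G` uses only the points and the queries up to `t`; the default 0 for later queries cannot
  -- influence a first alarm at `t`.
  let G : (σ → ℕ) → ℝ := fun w =>
    A.releaseProb μ (Finset.univ.image fun s => increasingPoint (w (Sum.inl s)))
      (fun u => if hu : u.1 ≤ t then increasingPoint (w (Sum.inr ⟨u, hu⟩)) else 0)
      (firstAlarmAt θ t)
  have hG : ∀ c : Fin n → Fin (T + 1), A.alarmProb μ θ c t =
      lim (Filter.map G ((genericIncreasing (Place n T)).map fun v => v ∘ ψ c)) := by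
    intro c
    rw [alarmProb, limUnder, Ultrafilter.coe_map, Filter.map_map]
    congr 2
    funext v
    refine A.releaseProb_firstAlarmAt_congr μ _ θ fun u hu => ?_
    simp only [hu, dif_pos]
    rfl
  have hinj : Function.Injective (ψ c) := by
    refine Function.Injective.sumElim (pointPlace_strictMono hc).injective
      ((queryPlace_strictMono n T).injective.comp Subtype.val_injective) fun s u hsu => ?_
    have h1 := pointPlace_lt_queryPlace (c := c) (s := s) (t := u.1)
    have h2 := queryPlace_lt_pointPlace (c := c) (s := s) (t := u.1)
    rw [hsu] at h1 h2
    simp only [lt_self_iff_false, false_iff] at h1 h2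
    omega
  rw [hG, hG, map_comp_genericIncreasing_congr hinj (ψ' := ψ c')]
  -- A point whose arrival time differs between `c` and `c'` lies beyond every query up to `t` in
  -- both.
  rintro (s | u) (s' | u')
  · exact (pointPlace_strictMono hc).lt_iff_lt.trans (pointPlace_strictMono hc').lt_iff_lt.symm
  · refine pointPlace_lt_queryPlace.trans (Iff.trans ?_ pointPlace_lt_queryPlace.symm)
    have := u'.2
    rcases h s with h | h
    · rw [h]
    · omega
  · refine queryPlace_lt_pointPlace.trans (Iff.trans ?_ queryPlace_lt_pointPlace.symm)
    have := u.2
    rcases h s' with h | h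
    · rw [h]
    · omega
  · exact Iff.rfl

/-- The event that the answers tell apart the counts `0` and `k`, by comparison with `θ`. -/
def separates (A : OnlineThresholdAlgorithm Ω T) (θ : ℝ) (k : ℕ) (S : Finset unitInterval)
    (q : Fin T → unitInterval) : Set Ω :=
  {ω | ∀ t, (thresholdCount S (q t) = 0 → A.releases S q ω t ≤ θ) ∧
    (thresholdCount S (q t) = k → θ < A.releases S q ω t)}

/-- If separation always had probability at least 0.99, false alarms would have limit probability at
most 0.01 (the `η` of the halving lemma). That lemma then yields a time with count `k` by which an
alarm has probability below 0.99. -/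
theorem exists_separates_lt_of_replaceNeighbors (A : OnlineThresholdAlgorithm Ω T) (μ : Measure Ω)
    [IsProbabilityMeasure μ] {n k : ℕ} {θ r δ : ℝ} (hr : 1 ≤ r) (hr2 : r < 2)
    (hk : 1 ≤ k) (hkn : k ≤ n) (hkT : 2 ^ (k - 1) ≤ T)
    (hpriv : ∀ q S S', ReplaceNeighbors S S' → ∀ F, MeasurableSet F →
      A.releaseProb μ S q F ≤ r * A.releaseProb μ S' q F + δ)
    (hlt : (r * 0.01 + k * δ) / (2 - r) < 0.99) :
    ∃ S : Finset unitInterval, S.card = n ∧ ∃ q, μ.real (A.separates θ k S q) < 0.99 := by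
  by_contra! hacc
  have hmeas : ∀ I : Finset ℕ, MeasurableSet (⋃ t ∈ I, firstAlarmAt (T := T) θ t) := fun I =>
    I.measurableSet_biUnion fun t _ => measurableSet_firstAlarmAt θ t
  obtain ⟨c, l, hc, hl, hc1, hc2, hsum⟩ := exists_arrivals_first_alarm_le
    (fun c : Fin n → Fin (T + 1) => A.alarmProb μ θ c) (r := r) (δ := δ) (η := 0.01) hr hr2
    (fun c t => A.alarmProb_nonneg μ θ c t) hk hkn hkT
    (by
      intro c j x hc hc' hx I
      refine le_of_tendsto_of_tendsto (A.tendsto_alarmProb μ θ _ I)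
        (((A.tendsto_alarmProb μ θ c I).const_mul r).add_const δ) ?_
      filter_upwards [eventually_strictMono_genericIncreasing (Place n T)] with v hv
      exact hpriv _ _ _ (replaceNeighbors_placedData hc hc' hx hv) _ (hmeas I))
    (fun c c' t hc hc' h => A.alarmProb_congr μ θ hc hc' h)
    (by
      refine le_of_tendsto (A.tendsto_alarmProb μ θ _ _) ?_
      filter_upwards [eventually_strictMono_genericIncreasing (Place n T)] with v hv
      have hconst : Monotone fun _ : Fin n => Fin.last T := fun _ _ _ => le_rfl
      have h1 := hacc _ (placedData_card hconst hv) (placedQuery v)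
      have hdisj : Disjoint (A.separates θ k (placedData (fun _ : Fin n => Fin.last T) v)
            (placedQuery v))
          {ω | A.releases (placedData (fun _ : Fin n => Fin.last T) v) (placedQuery v) ω ∈
            ⋃ t ∈ Finset.range T, firstAlarmAt θ t} := by
        rw [Set.disjoint_left]
        intro ω hω hω'
        simp only [Set.mem_ofPred_eq, Set.mem_iUnion] at hω'
        obtain ⟨t, -, ⟨ht, h2⟩, -⟩ := hω'
        refine not_le.2 h2 ((hω _).1 ?_)
        rw [thresholdCount_placedData hconst hv]
        rw [Finset.card_eq_zero, Finset.filter_eq_empty_iff]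
        intro s _
        simpa using ht
      have h2 := measureReal_union (μ := μ) hdisj (A.measurable_releases _ _ (hmeas _))
      have h3 := measureReal_le_one (μ := μ) (s := A.separates θ k
        (placedData (fun _ : Fin n => Fin.last T) v) (placedQuery v) ∪
          {ω | A.releases (placedData (fun _ : Fin n => Fin.last T) v) (placedQuery v) ω ∈
            ⋃ t ∈ Finset.range T, firstAlarmAt θ t})
      rw [releaseProb]
      linarith)
  refine absurd (hsum.trans_lt hlt) (not_lt.2 ?_)
  refine ge_of_tendsto (A.tendsto_alarmProb μ θ c _) ?_
  filter_upwards [eventually_strictMono_genericIncreasing (Place n T)] with v hv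
  refine (hacc _ (placedData_card hc hv) (placedQuery v)).trans (measureReal_mono ?_)
  intro ω hω
  have hcount : thresholdCount (placedData c v) (placedQuery v ⟨l, hl⟩) = k := by
    rw [thresholdCount_placedData hc hv]
    have : (Finset.univ.filter fun s : Fin n => (c s : ℕ) ≤ l) =
        Finset.univ.filter fun s : Fin n => s.1 < k := by
      ext s
      simp only [Finset.mem_filter, Finset.mem_univ, true_and]
      refine ⟨fun h => ?_, hc1 s⟩
      by_contra h'
      rw [hc2 s (not_lt.1 h'), Fin.val_last] at h
      omega
    rw [this, Fin.card_filter_val_lt]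
    omega
  obtain ⟨t, ht, hmem⟩ := exists_mem_firstAlarmAt (⟨l, hl⟩ : Fin T) ((hω _).2 hcount)
  simp only [Set.mem_ofPred_eq, Set.mem_iUnion]
  exact ⟨t, Finset.mem_range.2 (Nat.lt_succ_of_le ht), hmem⟩

end OnlineThresholdAlgorithm

/-! ### Add/remove neighbors: packing for two points, reduction to replacement -/

theorem thresholdCount_pair {a b m : ℕ} (hab : a ≠ b) :
    thresholdCount {increasingPoint a, increasingPoint b} (increasingPoint m) =
      (if a < m then 1 else 0) + if b < m then 1 else 0 := by
  have hne : increasingPoint a ≠ increasingPoint b := fun h =>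
    hab (strictMono_increasingPoint.injective h)
  have ha := strictMono_increasingPoint.lt_iff_lt (a := a) (b := m)
  have hb := strictMono_increasingPoint.lt_iff_lt (a := b) (b := m)
  rw [thresholdCount, Finset.card_filter, Finset.sum_pair hne]
  simp only [ha, hb]

namespace OnlineThresholdAlgorithm

variable {Ω : Type*} [MeasurableSpace Ω] {T : ℕ}

/-- Three pairwise disjoint datasets of two points whose answers to two queries differ are too close
to the empty dataset to be told apart. -/
theorem exists_separates_lt_of_addRemoveNeighbors (A : OnlineThresholdAlgorithm Ω T)
    (μ : Measure Ω) [IsProbabilityMeasure μ] {θ r δ : ℝ} (hr : 0 ≤ r) (hT : 2 ≤ T)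
    (hpriv : ∀ q S S', AddRemoveNeighbors S S' → ∀ F, MeasurableSet F →
      A.releaseProb μ S q F ≤ r * A.releaseProb μ S' q F + δ)
    (hlt : r * (r * (1 / 3) + δ) + δ < 0.99) :
    ∃ S : Finset unitInterval, S.card = 2 ∧ ∃ q, μ.real (A.separates θ 2 S q) < 0.99 := by
  by_contra! hacc
  -- Queries at 2 and 5 split the indices into the blocks 0, 1 and 3, 4 and 6, 7; each pair gives a
  -- different pattern of alarms at `t₀`, `t₁`.
  let q : Fin T → unitInterval := fun t => if t.1 = 0 then increasingPoint 2 else increasingPoint 5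
  let t₀ : Fin T := ⟨0, by omega⟩
  let t₁ : Fin T := ⟨1, by omega⟩
  -- Two removals lead to `∅`, so each of three disjoint events has probability above `1 / 3` there.
  have hempty : ∀ a b : ℕ, a ≠ b → ∀ F : Set (Fin T → ℝ), MeasurableSet F →
      (∀ ω ∈ A.separates θ 2 {increasingPoint a, increasingPoint b} q,
        A.releases {increasingPoint a, increasingPoint b} q ω ∈ F) →
      1 / 3 < A.releaseProb μ ∅ q F := by
    intro a b hab F hF hsep
    have hne : increasingPoint a ≠ increasingPoint b := fun h =>
      hab (strictMono_increasingPoint.injective h)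
    have h1 : 0.99 ≤ A.releaseProb μ {increasingPoint a, increasingPoint b} q F :=
      (hacc _ (Finset.card_pair hne) q).trans (measureReal_mono hsep)
    have h2 := hpriv q {increasingPoint a, increasingPoint b} {increasingPoint b}
      ⟨increasingPoint a, Or.inr ⟨by simpa using hne, rfl⟩⟩ F hF
    have h3 := hpriv q {increasingPoint b} ∅
      ⟨increasingPoint b, Or.inr ⟨by simp, rfl⟩⟩ F hF
    by_contra! h4
    have h5 : r * A.releaseProb μ {increasingPoint b} q F ≤ r * (r * (1 / 3) + δ) := by
      refine mul_le_mul_of_nonneg_left (h3.trans ?_) hr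
      gcongr
    linarith
  have hm : ∀ t : Fin T, MeasurableSet {y : Fin T → ℝ | θ < y t} := fun t =>
    measurableSet_lt measurable_const (measurable_pi_apply _)
  have hm' : ∀ t : Fin T, MeasurableSet {y : Fin T → ℝ | y t ≤ θ} := fun t =>
    measurableSet_le (measurable_pi_apply _) measurable_const
  have hA := hempty 0 1 (by simp) _ (hm t₀) fun ω hω =>
    (hω t₀).2 (by simp [q, t₀, thresholdCount_pair])
  have hB := hempty 3 4 (by simp) _ ((hm' t₀).inter (hm t₁)) fun ω hω =>
    ⟨(hω t₀).1 (by simp [q, t₀, thresholdCount_pair]),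
      (hω t₁).2 (by simp [q, t₁, thresholdCount_pair])⟩
  have hC := hempty 6 7 (by simp) _ ((hm' t₀).inter (hm' t₁)) fun ω hω =>
    ⟨(hω t₀).1 (by simp [q, t₀, thresholdCount_pair]),
      (hω t₁).1 (by simp [q, t₁, thresholdCount_pair])⟩
  have hmeas := A.measurable_releases ∅ q
  have h1 := measureReal_inter_add_sdiff (μ := μ) (s := A.releases ∅ q ⁻¹' {y | y t₀ ≤ θ})
    (hmeas (hm t₁))
  have h2 := probReal_add_probReal_compl (μ := μ) (hmeas (hm' t₀))
  have e1 : (A.releases ∅ q ⁻¹' {y | y t₀ ≤ θ})ᶜ = {ω | A.releases ∅ q ω ∈ {y | θ < y t₀}} := by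
    ext ω; simp
  have e2 : A.releases ∅ q ⁻¹' {y | y t₀ ≤ θ} \ A.releases ∅ q ⁻¹' {y | θ < y t₁} =
      {ω | A.releases ∅ q ω ∈ {y | y t₀ ≤ θ} ∩ {y | y t₁ ≤ θ}} := by
    ext ω; simp
  rw [e1] at h2
  rw [e2] at h1
  have e3 : μ.real (A.releases ∅ q ⁻¹' {y | y t₀ ≤ θ} ∩ A.releases ∅ q ⁻¹' {y | θ < y t₁}) =
    A.releaseProb μ ∅ q ({y | y t₀ ≤ θ} ∩ {y | θ < y t₁}) := rfl
  unfold releaseProb at *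
  linarith

theorem IsDP.replaceNeighbors {A : OnlineThresholdAlgorithm Ω T} {μ : Measure Ω} {ε δ : ℝ}
    (h : A.IsDP μ AddRemoveNeighbors ε δ) :
    ∀ q S S', ReplaceNeighbors S S' → ∀ F, MeasurableSet F →
      A.releaseProb μ S q F ≤
        Real.exp ε ^ 2 * A.releaseProb μ S' q F + (1 + Real.exp ε) * δ := by
  rintro q S S' ⟨R, x, y, hx, hy, -, rfl, rfl⟩ F hF
  have h1 := h q _ R ⟨x, Or.inr ⟨hx, rfl⟩⟩ F hF
  have h2 := h q R _ ⟨y, Or.inl ⟨hy, rfl⟩⟩ F hF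
  have h3 := mul_le_mul_of_nonneg_left h2 (Real.exp_pos ε).le
  unfold releaseProb
  linarith

end OnlineThresholdAlgorithm

/-! ### Choice of constants and conclusion -/

theorem theorem3 (n T : ℕ) (hn : 2 ≤ n) (hT : 1 ≤ T)
    (Nbr : Finset unitInterval → Finset unitInterval → Prop)
    (hNbr : Nbr = AddRemoveNeighbors ∨ Nbr = ReplaceNeighbors)
    {Ω : Type*} [MeasurableSpace Ω] (μ : Measure Ω) [IsProbabilityMeasure μ] :
    ¬ ∃ A : OnlineThresholdAlgorithm Ω T,
      A.IsDP μ Nbr 0.1 (1 / (n : ℝ) ^ 2) ∧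
      ∀ S : Finset unitInterval, S.card = n → ∀ q : Fin T → unitInterval,
        0.99 ≤ μ.real {ω | ∀ t : Fin T,
          A.error S q ω t ≤ (1 / 2) * min (n : ℝ) (Real.logb 2 (T : ℝ)) ∧
          A.error S q ω t < (n : ℝ) / 2} := by
  rintro ⟨A, hDP, hacc⟩
  set θ : ℝ := (1 / 2) * min (n : ℝ) (Real.logb 2 (T : ℝ)) with hθ
  set k := min n (Nat.log 2 T + 1) with hk
  have hk1 : 1 ≤ k := le_min (by omega) (by omega)
  have hkn : k ≤ n := min_le_left _ _
  have hkT : 2 ^ (k - 1) ≤ T :=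
    (Nat.pow_le_pow_right (by norm_num) (by omega)).trans (Nat.pow_log_le_self 2 (by omega))
  -- Either the error bound separates 0 from `k` strictly, or `k = n` and the strict bound `n / 2`
  -- does.
  have hkθ : θ < k - θ ∨ k = n := by
    rcases le_total n (Nat.log 2 T + 1) with h | h
    · exact Or.inr (min_eq_left h)
    · left
      have hlog : Real.logb 2 T < k := by
        rw [hk, min_eq_right h, Real.logb_lt_iff_lt_rpow (by norm_num) (by exact_mod_cast hT),
          Real.rpow_natCast]
        exact_mod_cast Nat.lt_pow_succ_log_self (by norm_num) T
      have := min_le_right (n : ℝ) (Real.logb 2 (T : ℝ))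
      linarith
  have hsep : ∀ S : Finset unitInterval, S.card = n → ∀ q, 0.99 ≤ μ.real (A.separates θ k S q) := by
    intro S hS q
    refine (hacc S hS q).trans (measureReal_mono fun ω hω t => ⟨fun h0 => ?_, fun h0 => ?_⟩)
    · have := (abs_le.1 (hω t).1).2
      rw [h0] at this
      simpa using this
    · have h1 := (abs_le.1 (hω t).1).1
      have h2 := (abs_lt.1 (hω t).2).1
      rw [h0] at h1 h2
      rcases hkθ with h | h
      · linarith
      · have := min_le_left (n : ℝ) (Real.logb 2 (T : ℝ))
        rw [h] at h2
        linarith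
  have hexp1 : 1 ≤ Real.exp 0.1 := Real.one_le_exp (by norm_num)
  have hexp2 : Real.exp 0.1 ≤ 10 / 9 :=
    (Real.exp_bound_div_one_sub_of_interval (by norm_num) (by norm_num)).trans (by norm_num)
  have hn' : (2 : ℝ) ≤ n := by exact_mod_cast hn
  have hkδ : (k : ℝ) * (1 / (n : ℝ) ^ 2) ≤ 1 / n := by
    have : (k : ℝ) ≤ n := by exact_mod_cast hkn
    calc (k : ℝ) * (1 / (n : ℝ) ^ 2) ≤ (n : ℝ) * (1 / (n : ℝ) ^ 2) := by gcongr
      _ = 1 / (n : ℝ) := by field_simp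
  have hreplace : ∀ r δ : ℝ, 1 ≤ r → r < 2 →
      (∀ q S S', ReplaceNeighbors S S' → ∀ F, MeasurableSet F →
        A.releaseProb μ S q F ≤ r * A.releaseProb μ S' q F + δ) →
      0.99 * (2 - r) ≤ r * 0.01 + k * δ := by
    intro r δ hr hr2 hpriv
    by_contra! hlt
    obtain ⟨S, hS, q, h⟩ := A.exists_separates_lt_of_replaceNeighbors μ (θ := θ) hr hr2 hk1 hkn hkT
      hpriv ((div_lt_iff₀ (by linarith)).2 hlt)
    exact absurd (hsep S hS q) (not_le.2 h)
  rcases hNbr with rfl | rfl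
  · have hr2 : Real.exp 0.1 ^ 2 ≤ 100 / 81 := by nlinarith
    have h := hreplace _ _ (by nlinarith) (by linarith) hDP.replaceNeighbors
    have hδ : (k : ℝ) * ((1 + Real.exp 0.1) * (1 / (n : ℝ) ^ 2)) ≤
        19 / 9 * (k * (1 / (n : ℝ) ^ 2)) := by
      have : 0 ≤ (k : ℝ) * (1 / (n : ℝ) ^ 2) := by positivity
      nlinarith
    -- For `n ≥ 3`, `0.99 * (62 / 81) ≈ 0.758` exceeds `1 / 81 + 19 / 27 ≈ 0.716`; for `n = k = 2`
    -- the term `19 / 18` is too large.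
    have hn2 : n = 2 := by
      by_contra hne
      have h3 : (3 : ℝ) ≤ n := by exact_mod_cast (show 3 ≤ n by omega)
      have : 1 / (n : ℝ) ≤ 1 / 3 := by gcongr
      linarith
    subst hn2
    have hk2 : k = 2 := by
      by_contra hne
      have hk' : k = 1 := by omega
      rw [hk'] at hδ h
      norm_num at hδ h
      linarith
    rw [hk2] at hsep hkT
    obtain ⟨S, hS, q, h⟩ := A.exists_separates_lt_of_addRemoveNeighbors μ (θ := θ)
      (r := Real.exp 0.1) (δ := 1 / 4) (by linarith) (by simpa using hkT)
      (fun q S S' hS F hF => by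
        have := hDP q S S' hS F hF
        norm_num at this ⊢
        exact this)
      (by nlinarith)
    exact absurd (hsep S hS q) (not_le.2 h)
  · have h := hreplace _ _ hexp1 (by linarith) hDP
    have : 1 / (n : ℝ) ≤ 1 / 2 := by gcongr
    linarith
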